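/- **Circuits.** A circuit $C$ on $l$ qubits has $T$ steps and starts from $|0\rangle^{\otimes l}$. Step $i$ applies a unitary $U_i$, then a collapsing computational-basis measurement $M_i$ of some set of the qubits (possibly empty), and then either a non-collapsing measurement of all qubits, or a query $O_x:|k,b\rangle\mapsto(-1)^{x(k)b}|k,b\rangle$ to an input $x\in\{0,1\}^N$. Let $P$ and $Q$ be the numbers of non-collapsing measurements and of queries, $T=P+Q$. Given the outcomes of the collapsing measurements, let $|\phi_i\rangle$ be the normalized state after step $i$, and let $a_{i,n}$ be the probability, given the earlier outcomes, that $M_i$ has outcome $n$. Run on $C$, the original process returns for each non-collapsing measurement, say at step $i$, an independent sample $v_i$ of $|\phi_i\rangle$ in the computational basis. **The circuit $C^*$.** $C^*$ has one $l$-qubit register, initially $|0\rangle^{\otimes l}$, for each non-collapsing measurement (or, alternatively, one for each step). Step $i$ acts on the $r_i$ registers whose label $j$ satisfies $j\ge i$ ($r_i=P-i+1$ if there are no queries): it applies $U_i^{\otimes r_i}$, then $M_i^*=\sum_n d_{i,n}(|n\rangle\langle n|)^{\otimes r_i}$ with $d_{i,n}=1/a_{i,n}^{\,r_i-1}$, that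 is, on state $|\psi\rangle$ the outcome $n$ gets weight $d_{i,n}\langle\psi|(|n\rangle\langle n|)^{\otimes r_i}|\psi\rangle$ and leaves the normalized vector $(|n\rangle\langle n|)^{\otimes r_i}|\psi\rangle$, where $a_{i,n}$ is taken for the same earlier outcomes; and then $O_x^{\otimes r_i}$ if step $i$ is a query. At the end the registers of the non-collapsing measurements are measured in the computational basis. **Classes.** Fix a finite set of unitary gates. The oracle $\mathcal Q_P$ takes a description of a query-free circuit $C=(U_1,M_1,\dots,U_P,M_P)$, each $U_i$ being a product of gates, and returns $v_1,\dots,v_P$ from the original process; $\mathcal Q_P^*$ takes the same input and returns the results of the final measurement of $C^*$. $\mathsf{PDQP}$ is the class of languages recognized by a polynomial-time deterministic Turing machine with one query to $\mathcal Q_P$ with error probability at most $1/3$. **Statement.** 1. $\mathsf{PDQP}$ equals the class of languages recognized by a polynomial-time deterministic Turing machine with one query to $\mathcal Q_P^*$ with error probability at most $1/3$. 2. For every circuit $C$ (with arbitrary unitaries $U_i$) and every input $x$: for each sequence of outcomes, $M_i^*$ gives each outcome $n$ exactly the weight $a_{i,n}$, and the final state of $C^*$ is $\bigotimes_j|\phi_j\rangle$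 over its registers $j$. The measured outputs of $C^*$ have the same distribution as the samples of the original process, and this is a probability distribution. 3. For every (possibly partial) Boolean function $f$ on $\{0,1\}^N$ and all $Q,P$: $f$ can be computed with error at most $1/3$ by a circuit with $Q$ queries and $P$ non-collapsing measurements, followed by classical post-processing of the samples, in the original model if and only if it can in the model that runs $C^*$. In particular the least value of $Q+P$ is the same in both models. -/

import Mathlib

open scoped ENNReal

noncomputable section

namespace NonCollapsing

/-! ### States of `l` qubits -/

/-- Computational basis strings of `l` qubits. -/
abbrev Str (l : ℕ) : Type := Fin l → Bool

/-- Squared Euclidean norm of a vector of amplitudes. -/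
def normSq {ι : Type} [Fintype ι] (ψ : ι → ℂ) : ℝ := ∑ x, ‖ψ x‖ ^ 2

/-- The vector `ψ / ‖ψ‖` (and `0` for `ψ = 0`). -/
def normalize {ι : Type} [Fintype ι] (ψ : ι → ℂ) : ι → ℂ :=
  fun x => ψ x / ((Real.sqrt (normSq ψ) : ℝ) : ℂ)

/-- The projector `|n⟩⟨n|` on the qubits in `S`, identity on the other qubits. -/
def proj {l : ℕ} (S : Finset (Fin l)) (n : S → Bool) (ψ : Str l → ℂ) : Str l → ℂ :=
  fun x => if ∀ q : S, x q.1 = n q then ψ x else 0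

/-! ### Circuits with collapsing measurements, non-collapsing measurements and queries -/

/-- The qubits on which a query to an `N`-bit input acts: `⌈log₂ N⌉` index qubits (least significant
first), and as last entry the qubit `b`. -/
abbrev QueryWires (N l : ℕ) : Type := Fin (Nat.clog 2 N + 1) ↪ Fin l

/-- A circuit of `T` steps on `l` qubits. Step `i` applies the unitary `U i`, then the collapsing
measurement of the qubits in `S i` in the computational basis, and then either makes a
non-collapsing measurement of all qubits (`query i = none`) or a query to the input on the given
wires. -/
structure Circuit (N l T : ℕ) where
  U : Fin T → Matrix.unitaryGroup (Str l) ℂ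
  S : Fin T → Finset (Fin l)
  query : Fin T → Option (QueryWires N l)

/-- The index held by the index qubits in basis state `y`. -/
def queryIndex {N l : ℕ} (w : QueryWires N l) (y : Str l) : ℕ :=
  ∑ j : Fin (Nat.clog 2 N), if y (w j.castSucc) then 2 ^ (j : ℕ) else 0

/-- The phase of `|y⟩` under `O_x : |i, b⟩ ↦ (-1)^{x(i) b} |i, b⟩` (identity when `i ≥ N`). -/
def queryPhase {N l : ℕ} (w : QueryWires N l) (x : Fin N → Bool) (y : Str l) : ℂ :=
  if h : queryIndex w y < N then
    if x ⟨queryIndex w y, h⟩ && y (w (Fin.last _)) then -1 else 1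
  else 1

/-- The gate at the end of a step: `O_x` in a query step, the identity otherwise. -/
def queryGate {N l : ℕ} (o : Option (QueryWires N l)) (x : Fin N → Bool) :
    Matrix (Str l) (Str l) ℂ :=
  match o with
  | none => 1
  | some w => Matrix.diagonal (queryPhase w x)

namespace Circuit

variable {N l T : ℕ}

/-- The steps at which a non-collapsing measurement is made. -/
abbrev Sample (C : Circuit N l T) : Type := {i : Fin T // C.query i = none}

/-- The number `P` of non-collapsing measurements. -/
def numSamples (C : Circuit N l T) : ℕ := Fintype.card C.Sample

/-- The number `Q` of queries. -/
def numQueries (C : Circuit N l T) : ℕ := Fintype.card {i : Fin T // C.query i ≠ none}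

/-- A sequence of outcomes of all the collapsing measurements. -/
abbrev History (C : Circuit N l T) : Type := ∀ i : Fin T, (C.S i → Bool)

/-! #### The original process -/

/-- The state `|φ_t⟩` after the first `t` steps, given the outcomes `h` of the collapsing
measurements (it is `0` once an outcome of probability zero has occurred). -/
def state (C : Circuit N l T) (x : Fin N → Bool) (h : C.History) : ℕ → (Str l → ℂ)
  | 0 => Pi.single (fun _ => false) 1
  | t + 1 =>
    if ht : t < T then
      (queryGate (C.query ⟨t, ht⟩) x).mulVec
        (normalize (proj (C.S ⟨t, ht⟩) (h ⟨t, ht⟩)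
          ((C.U ⟨t, ht⟩).1.mulVec (C.state x h t))))
    else C.state x h t

/-- `a_{i,n}` for `n = h i`: the probability that the collapsing measurement of step `i` has outcome
`h i`, given the outcomes `h` of the earlier steps. -/
def prob (C : Circuit N l T) (x : Fin N → Bool) (h : C.History) (i : Fin T) : ℝ :=
  normSq (proj (C.S i) (h i) ((C.U i).1.mulVec (C.state x h i)))

/-- The probability that the non-collapsing measurements give `v`: the outcomes `h` of the collapsing
measurements are drawn step by step, and each `v i` is an independent sample of the state at its
step. -/
def output (C : Circuit N l T) (x : Fin N → Bool) (v : C.Sample → Str l) : ℝ :=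
  ∑ h : C.History, (∏ i, C.prob x h i) * ∏ j : C.Sample, ‖C.state x h (j.1 + 1) (v j)‖ ^ 2

end Circuit

/-! ### The parallel circuit `C*` -/

/-- Which steps own a register of `C*`: only those with a non-collapsing measurement, or all of them.
The two agree for circuits without queries. With all steps, `r_i = P + Q - i + 1`. -/
inductive Layout
  | perMeasurement
  | perStep

namespace Circuit

variable {N l T : ℕ}

/-- The steps that own a register of `C*`. -/
def registers (C : Circuit N l T) : Layout → Finset (Fin T)
  | .perMeasurement => Finset.univ.filter fun i => C.query i = none
  | .perStep => Finset.univ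

theorem sample_mem_registers (C : Circuit N l T) (lay : Layout) (j : C.Sample) :
    j.1 ∈ C.registers lay := by
  cases lay <;> simp [registers, j.2]

/-- Basis states of the parallel registers. -/
abbrev StarStr (C : Circuit N l T) (lay : Layout) : Type := C.registers lay → Str l

/-- `r_i`: the number of registers that step `i` acts on. -/
def numActive (C : Circuit N l T) (lay : Layout) (i : Fin T) : ℕ :=
  ((C.registers lay).filter fun j => i ≤ j).card

/-- `A^{⊗ r_i}` on the registers `j ≥ i`, identity on the other registers. -/
def onActive (C : Circuit N l T) (lay : Layout) (i : Fin T) (A : Matrix (Str l) (Str l) ℂ) :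
    Matrix (C.StarStr lay) (C.StarStr lay) ℂ :=
  fun w w' => ∏ j : C.registers lay,
    if i ≤ j.1 then A (w j) (w' j) else (1 : Matrix (Str l) (Str l) ℂ) (w j) (w' j)

/-- `(|n⟩⟨n|)^{⊗ r_i}` on the registers `j ≥ i`, identity on the other registers. -/
def starProj (C : Circuit N l T) (lay : Layout) (i : Fin T) (n : C.S i → Bool)
    (ψ : C.StarStr lay → ℂ) : C.StarStr lay → ℂ :=
  fun w => if ∀ j : C.registers lay, i ≤ j.1 → ∀ q : C.S i, w j q.1 = n q then ψ w else 0

/-- The state `|ψ*_t⟩` of `C*` after the first `t` steps, given the outcomes `h` of the measurements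
`M*_i`. A positive factor such as `d_{i,n}` drops out of the normalized state after the
measurement. -/
def starState (C : Circuit N l T) (lay : Layout) (x : Fin N → Bool) (h : C.History) :
    ℕ → (C.StarStr lay → ℂ)
  | 0 => Pi.single (fun _ _ => false) 1
  | t + 1 =>
    if ht : t < T then
      (C.onActive lay ⟨t, ht⟩ (queryGate (C.query ⟨t, ht⟩) x)).mulVec
        (normalize (C.starProj lay ⟨t, ht⟩ (h ⟨t, ht⟩)
          ((C.onActive lay ⟨t, ht⟩ (C.U ⟨t, ht⟩).1).mulVec (C.starState lay x h t))))
    else C.starState lay x h t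

/-- `d_{i,n} = 1 / a_{i,n}^{r_i - 1}` for `n = h i`. The exponent is an integer, since no register is
active in steps after the last one that owns a register. -/
def reweight (C : Circuit N l T) (lay : Layout) (x : Fin N → Bool) (h : C.History) (i : Fin T) : ℝ :=
  1 / (C.prob x h i) ^ ((C.numActive lay i : ℤ) - 1)

/-- The weight `d_{i,n} ⟨ψ| (|n⟩⟨n|)^{⊗ r_i} |ψ⟩` that `M*_i = ∑ₙ d_{i,n} (|n⟩⟨n|)^{⊗ r_i}` gives to
the outcome `n = h i`, where `|ψ⟩ = U*_i |ψ*_{i-1}⟩`. -/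
def starProb (C : Circuit N l T) (lay : Layout) (x : Fin N → Bool) (h : C.History) (i : Fin T) : ℝ :=
  C.reweight lay x h i *
    normSq (C.starProj lay i (h i) ((C.onActive lay i (C.U i).1).mulVec (C.starState lay x h i)))

/-- The weight with which a measurement of the final state of `C*` gives `v` on the registers of the
non-collapsing measurements; registers of query steps, if present, are discarded. -/
def starOutput (C : Circuit N l T) (lay : Layout) (x : Fin N → Bool) (v : C.Sample → Str l) : ℝ :=
  ∑ h : C.History, (∏ i, C.starProb lay x h i) *
    ∑ w : C.StarStr lay,
      if ∀ j : C.Sample, w ⟨j.1, C.sample_mem_registers lay j⟩ = v j then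
        ‖C.starState lay x h T w‖ ^ 2 else 0

end Circuit

/-! ### The query models -/

/-- A circuit with classical postprocessing `g` of the samples, whose output weights on input `x` are
`out x`, computes `f` on the inputs in `D` with error probability at most `1/3`. -/
def Computes {N : ℕ} {V : Type} [Fintype V] (out : (Fin N → Bool) → V → ℝ) (g : V → Bool)
    (D : Set (Fin N → Bool)) (f : (Fin N → Bool) → Bool) : Prop :=
  ∀ x ∈ D, 2 / 3 ≤ ∑ v, if g v = f x then out x v else 0

/-- The pairs `(Q, P)` such that `f` on `D` can be computed with `Q` queries and `P` non-collapsing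
measurements in the original model. -/
def cost {N : ℕ} (D : Set (Fin N → Bool)) (f : (Fin N → Bool) → Bool) : Set (ℕ × ℕ) :=
  {c | ∃ (l T : ℕ) (C : Circuit N l T) (g : (C.Sample → Str l) → Bool),
    C.numQueries = c.1 ∧ C.numSamples = c.2 ∧ Computes C.output g D f}

/-- The pairs `(Q, P)` such that `f` on `D` can be computed with `Q` queries and `P` non-collapsing
measurements in the model that runs `C*`. -/
def starCost {N : ℕ} (lay : Layout) (D : Set (Fin N → Bool)) (f : (Fin N → Bool) → Bool) :
    Set (ℕ × ℕ) :=
  {c | ∃ (l T : ℕ) (C : Circuit N l T) (g : (C.Sample → Str l) → Bool),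
    C.numQueries = c.1 ∧ C.numSamples = c.2 ∧ Computes (C.starOutput lay) g D f}

/-- The least `Q + P` over a set of pairs (`⊤` for the empty set). -/
def leastTotal (A : Set (ℕ × ℕ)) : ℕ∞ := ⨅ c ∈ A, ((c.1 + c.2 : ℕ) : ℕ∞)

/-! ### Circuits over a finite gate set, and their description by bit strings -/

/-- A finite set of unitary gates. -/
structure GateSet where
  size : ℕ
  arity : Fin size → ℕ
  mat : ∀ g, Matrix.unitaryGroup (Str (arity g)) ℂ

/-- A gate and the distinct qubits to which it is applied. -/
structure PlacedGate (G : GateSet) (l : ℕ) where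
  gate : Fin G.size
  wires : Fin (G.arity gate) ↪ Fin l

/-- The action of a gate on the given wires of `l` qubits. -/
def placedMatrix {k l : ℕ} (w : Fin k ↪ Fin l) (A : Matrix (Str k) (Str k) ℂ) :
    Matrix (Str l) (Str l) ℂ :=
  fun x y => if ∀ q, q ∉ Set.range w → x q = y q then A (x ∘ w) (y ∘ w) else 0

/-- A string on `l` qubits splits into its part on the wires and the rest. -/
def splitStr {k l : ℕ} (w : Fin k ↪ Fin l) :
    Str l → Str k × ({q // q ∉ Set.range w} → Bool) :=
  fun x => (x ∘ w, fun q => x q.1)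

theorem splitStr_bijective {k l : ℕ} (w : Fin k ↪ Fin l) : Function.Bijective (splitStr w) := by
  classical
  constructor
  · intro x y hxy
    simp only [splitStr, Prod.mk.injEq] at hxy
    funext q
    by_cases hq : q ∈ Set.range w
    · obtain ⟨j, rfl⟩ := hq
      exact congrFun hxy.1 j
    · exact congrFun hxy.2 ⟨q, hq⟩
  · rintro ⟨a, b⟩
    refine ⟨fun q => if hq : q ∈ Set.range w then a hq.choose else b ⟨q, hq⟩, ?_⟩
    simp only [splitStr, Prod.mk.injEq]
    constructor
    · funext j
      have hj : w j ∈ Set.range w := ⟨j, rfl⟩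
      simp only [Function.comp_apply, dif_pos hj]
      exact congrArg a (w.injective hj.choose_spec)
    · funext q
      simp only [dif_neg q.2]

open scoped Kronecker in
theorem placedMatrix_mem {k l : ℕ} (w : Fin k ↪ Fin l) (A : Matrix.unitaryGroup (Str k) ℂ) :
    placedMatrix w A.1 ∈ Matrix.unitaryGroup (Str l) ℂ := by
  classical
  let e := Equiv.ofBijective _ (splitStr_bijective w)
  have h : placedMatrix w A.1 = (A.1 ⊗ₖ
      (1 : Matrix ({q // q ∉ Set.range w} → Bool) ({q // q ∉ Set.range w} → Bool) ℂ)).submatrix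
        e e := by
    ext x y
    simp only [placedMatrix, Matrix.submatrix_apply, Matrix.kroneckerMap_apply, Matrix.one_apply, e,
      Equiv.ofBijective_apply, splitStr, funext_iff, Subtype.forall]
    split_ifs <;> simp
  have hk := Matrix.kronecker_mem_unitary A.2
    (one_mem (unitary (Matrix ({q // q ∉ Set.range w} → Bool) ({q // q ∉ Set.range w} → Bool) ℂ)))
  rw [Matrix.mem_unitaryGroup_iff, h, Matrix.star_eq_conjTranspose, Matrix.conjTranspose_submatrix,
    Matrix.submatrix_mul_equiv, ← Matrix.star_eq_conjTranspose, Unitary.mul_star_self_of_mem hk,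
    Matrix.submatrix_one_equiv]

/-- The unitary of a placed gate. -/
def PlacedGate.unitary {G : GateSet} {l : ℕ} (p : PlacedGate G l) :
    Matrix.unitaryGroup (Str l) ℂ :=
  ⟨placedMatrix p.wires (G.mat p.gate).1, placedMatrix_mem p.wires (G.mat p.gate)⟩

/-- One step of a circuit over a gate set: gates, in the order in which they are applied, and the set
of qubits measured after them. -/
structure GateStep (G : GateSet) (l : ℕ) where
  gates : List (PlacedGate G l)
  measured : Finset (Fin l)

/-- The input of the oracles: a circuit `C = (U_1, M_1, …, U_P, M_P)` over a gate set. -/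
structure GateCircuit (G : GateSet) where
  width : ℕ
  steps : List (GateStep G width)

/-- The circuit without queries that is described by a list of gates. -/
def GateCircuit.toCircuit {G : GateSet} (D : GateCircuit G) :
    Circuit 0 D.width D.steps.length where
  U i := ((D.steps.get i).gates.map PlacedGate.unitary).reverse.prod
  S i := (D.steps.get i).measured
  query _ := none

/-- `n` in unary, ended by `false`. -/
def encNat (n : ℕ) : List Bool := List.replicate n true ++ [false]

/-- A list, each entry announced by `true`, ended by `false`. -/
def encList {α : Type} (enc : α → List Bool) : List α → List Bool
  | [] => [false]
  | a :: as => true :: (enc a ++ encList enc as)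

def encGate {G : GateSet} {l : ℕ} (p : PlacedGate G l) : List Bool :=
  encNat p.gate ++ encList encNat (List.ofFn fun j => (p.wires j : ℕ))

def encStep {G : GateSet} {l : ℕ} (s : GateStep G l) : List Bool :=
  encList encGate s.gates ++ List.ofFn fun q => decide (q ∈ s.measured)

/-- The bit string that describes a circuit. -/
def encCircuit {G : GateSet} (D : GateCircuit G) : List Bool :=
  encNat D.width ++ encList encStep D.steps

/-- A self-delimiting encoding. -/
def SelfDelimiting {α : Type} (enc : α → List Bool) : Prop :=
  ∀ a b r s, enc a ++ r = enc b ++ s → a = b ∧ r = s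

theorem selfDelimiting_encNat : SelfDelimiting encNat := by
  intro a
  induction a with
  | zero => intro b r s h; cases b <;> simp_all [encNat, List.replicate_succ]
  | succ a ih =>
    intro b r s h
    cases b with
    | zero => simp [encNat, List.replicate_succ] at h
    | succ b =>
      have := ih b r s (by simpa [encNat, List.replicate_succ] using h)
      simpa using this

theorem selfDelimiting_encList {α : Type} {enc : α → List Bool} (he : SelfDelimiting enc) :
    SelfDelimiting (encList enc) := by
  intro a
  induction a with
  | nil => intro b r s h; cases b <;> simp_all [encList]
  | cons a as ih =>
    intro b r s h
    cases b with
    | nil => simp [encList] at h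
    | cons b bs =>
      simp only [encList, List.cons_append, List.cons.injEq, List.append_assoc, true_and] at h
      obtain ⟨rfl, h2⟩ := he _ _ _ _ h
      obtain ⟨rfl, h3⟩ := ih _ _ _ h2
      exact ⟨rfl, h3⟩

theorem selfDelimiting_encGate {G : GateSet} {l : ℕ} :
    SelfDelimiting (encGate : PlacedGate G l → List Bool) := by
  rintro ⟨g, w⟩ ⟨g', w'⟩ r s h
  simp only [encGate, List.append_assoc] at h
  obtain ⟨h1, h2⟩ := selfDelimiting_encNat _ _ _ _ h
  obtain rfl : g = g' := Fin.ext h1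
  obtain ⟨h3, h4⟩ := selfDelimiting_encList selfDelimiting_encNat _ _ _ _ h2
  have h5 := List.ofFn_injective h3
  refine ⟨?_, h4⟩
  congr 1
  ext j
  exact congrFun h5 j

theorem selfDelimiting_encStep {G : GateSet} {l : ℕ} :
    SelfDelimiting (encStep : GateStep G l → List Bool) := by
  rintro ⟨gs, S⟩ ⟨gs', S'⟩ r s h
  simp only [encStep, List.append_assoc] at h
  obtain ⟨rfl, h2⟩ := selfDelimiting_encList selfDelimiting_encGate _ _ _ _ h
  obtain ⟨h3, h4⟩ := List.append_inj h2 (by simp)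
  have h5 := List.ofFn_injective h3
  refine ⟨?_, h4⟩
  congr 1
  ext q
  simpa using congrFun h5 q

theorem encCircuit_injective {G : GateSet} :
    Function.Injective (encCircuit : GateCircuit G → List Bool) := by
  rintro ⟨l, st⟩ ⟨l', st'⟩ h
  simp only [encCircuit] at h
  obtain ⟨rfl, h2⟩ := selfDelimiting_encNat _ _ _ _ h
  obtain ⟨rfl, -⟩ := selfDelimiting_encList selfDelimiting_encStep _ _ [] [] (by simpa using h2)
  rfl

/-! ### Oracle Turing machines -/

/-- A randomized oracle: `O q s` is the weight of the answer `s` to the query `q`. -/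
abbrev Oracle : Type := List Bool → List Bool → ℝ≥0∞

/-- The control of an oracle machine: an ordinary state, a call of the oracle after which the machine
continues in state `q`, or one of the two halting states. -/
inductive Control (Q : Type)
  | run (q : Q)
  | call (q : Q)
  | accept
  | reject

/-- A deterministic multitape oracle Turing machine with tape alphabet blank, `0`, `1`
(`none` is the blank). Tape `0` holds the input, tape `1` is the oracle tape. In an ordinary state,
depending on the symbols under the heads, every head writes a symbol and moves by at most one cell. -/
structure OracleTM where
  extraTapes : ℕ
  Q : Type
  finite : Finite Q
  start : Q
  trans : Q → (Fin (extraTapes + 2) → Option Bool) →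
    Control Q × (Fin (extraTapes + 2) → Option Bool × Option Turing.Dir)

/-- The word on a tape from the head rightwards up to the first blank. -/
def tapeWord (t : Turing.Tape (Option Bool)) : List Bool :=
  (List.range (sInf {n : ℕ | t.nth n = none})).map fun i : ℕ => (t.nth (i : ℤ)).getD false

/-- The tape with a word written from the head rightwards, blank elsewhere. -/
def wordTape (s : List Bool) : Turing.Tape (Option Bool) := Turing.Tape.mk₁ (s.map some)

namespace OracleTM

/-- A configuration; it also counts the queries made so far. -/
structure Cfg (M : OracleTM) where
  control : Control M.Q
  tapes : Fin (M.extraTapes + 2) → Turing.Tape (Option Bool)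
  queries : ℕ

/-- The initial configuration on input `x`. -/
def init (M : OracleTM) (x : List Bool) : M.Cfg where
  control := .run M.start
  tapes i := wordTape (if i = 0 then x else [])
  queries := 0

/-- An ordinary step from state `q`. -/
def ordinary (M : OracleTM) (c : M.Cfg) (q : M.Q) : M.Cfg :=
  let a := M.trans q fun i => (c.tapes i).head
  { control := a.1
    tapes := fun i =>
      let t := (c.tapes i).write (a.2 i).1
      match (a.2 i).2 with
      | none => t
      | some d => t.move d
    queries := c.queries }

/-- The configuration after the oracle has answered `s`: the oracle tape now holds `s`. -/
def answered (M : OracleTM) (c : M.Cfg) (q : M.Q) (s : List Bool) : M.Cfg where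
  control := .run q
  tapes := Function.update c.tapes 1 (wordTape s)
  queries := c.queries + 1

open scoped Classical in
/-- The weight of the transition from `c` to `c'` in one step; a call of the oracle is one step, and
halted configurations do not change. -/
def stepWeight (M : OracleTM) (O : Oracle) (c c' : M.Cfg) : ℝ≥0∞ :=
  match c.control with
  | .run q => if c' = M.ordinary c q then 1 else 0
  | .call q => ∑' s, if c' = M.answered c q s then O (tapeWord (c.tapes 1)) s else 0
  | .accept => if c' = c then 1 else 0
  | .reject => if c' = c then 1 else 0

open scoped Classical in
/-- The distribution of the configuration after `t` steps on input `x`. -/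
def dist (M : OracleTM) (O : Oracle) (x : List Bool) : ℕ → M.Cfg → ℝ≥0∞
  | 0 => fun c => if c = M.init x then 1 else 0
  | t + 1 => fun c' => ∑' c, M.dist O x t c * M.stepWeight O c c'

open scoped Classical in
/-- `M` recognizes `L` in polynomial time with at most one query to `O`, with error probability at
most `1/3` on every input. -/
def Recognizes (M : OracleTM) (O : Oracle) (L : Language Bool) : Prop :=
  ∃ p : Polynomial ℕ, ∀ x : List Bool,
    (∀ c, M.dist O x (p.eval x.length) c ≠ 0 →
      (c.control = .accept ∨ c.control = .reject) ∧ c.queries ≤ 1) ∧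
    (x ∈ L → 2 / 3 ≤ ∑' c, if c.control = .accept then M.dist O x (p.eval x.length) c else 0) ∧
    (x ∉ L → 2 / 3 ≤ ∑' c, if c.control = .reject then M.dist O x (p.eval x.length) c else 0)

end OracleTM

/-- The languages recognized by a polynomial-time deterministic Turing machine with one query to the
randomized oracle `O`, with error probability at most `1/3`. -/
def oneQueryClass (O : Oracle) : Set (Language Bool) := {L | ∃ M : OracleTM, M.Recognizes O L}

/-! ### The oracles and the classes -/

/-- The oracle whose answer to the description of a circuit `D` is the concatenation of strings
`v_1 … v_P` drawn with weight `out D v`. A query that describes no circuit is answered by the empty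
word. -/
def sampleOracle {G : GateSet}
    (out : ∀ D : GateCircuit G, (Fin D.steps.length → Str D.width) → ℝ) : Oracle :=
  fun q s =>
    match Function.partialInv encCircuit q with
    | none => if s = [] then 1 else 0
    | some D => ∑ v, if s = (List.ofFn fun i => List.ofFn (v i)).flatten then
        ENNReal.ofReal (out D v) else 0

/-- The oracle `𝒬_P`; `P` is the number of steps of the circuit in the query. -/
def oracleQ (G : GateSet) : Oracle :=
  sampleOracle fun D : GateCircuit G => fun v => D.toCircuit.output Fin.elim0 fun j => v j.1

/-- The oracle `𝒬*_P`. -/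
def oracleQStar (G : GateSet) : Oracle :=
  sampleOracle fun D : GateCircuit G => fun v =>
    D.toCircuit.starOutput .perStep Fin.elim0 fun j => v j.1

/-- The class `PDQP`, for circuits over the gate set `G`. -/
def PDQP (G : GateSet) : Set (Language Bool) := oneQueryClass (oracleQ G)

/-- The class defined like `PDQP`, with the oracle `𝒬*_P` in place of `𝒬_P`. -/
def PDQPStar (G : GateSet) : Set (Language Bool) := oneQueryClass (oracleQStar G)

end NonCollapsing

end

namespace NonCollapsing

/-! ### Squared norms -/

section Norm

variable {ι κ : Type} [Fintype ι] [Fintype κ]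

/-! Fix a sequence of outcomes. Unitaries, projectors and queries act on `C*` factor by factor, and
normalizing a product vector normalizes its factors. So the registers stay in a product state: after
`t` steps register `j` holds the original state after `min t (j + 1)` steps, since it is frozen once
its own step is done (`starState_eq_prod`).

The `r` active registers are then identical copies, and all of them show outcome `n` with weight `a
^ r`; the factor `1 / a ^ (r - 1)` restores `a` (`starProb_eq_prob`). Outcome sequences thus have
the same weights in both processes. Given one of nonzero weight, measuring the final product state
samples the states independently, and discarded registers contribute their squared norm `1`
(`sum_starState_eq`). Hence the output weights agree, the two oracles are the same function, and the
two sets of costs are equal.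

Impossible outcomes need care: normalizing `0` gives `0`, so every state has squared norm `0` or
`1`, and the identities hold for all outcome sequences. That the weights sum to one follows by
passing from uniform outcomes to those of the process one step at a time (`sum_prod_prob_of_le`). -/

theorem normSq_nonneg (ψ : ι → ℂ) : 0 ≤ normSq ψ :=
  Finset.sum_nonneg fun _ _ => sq_nonneg _

theorem normSq_zero : normSq (0 : ι → ℂ) = 0 := by simp [normSq]

theorem normSq_eq_zero {ψ : ι → ℂ} : normSq ψ = 0 ↔ ψ = 0 := by
  rw [normSq, Finset.sum_eq_zero_iff_of_nonneg fun _ _ => sq_nonneg _]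
  simp [funext_iff]

theorem normSq_eq_dotProduct (ψ : ι → ℂ) : (normSq ψ : ℂ) = star ψ ⬝ᵥ ψ := by
  simp [normSq, dotProduct, Complex.conj_mul']

theorem normSq_mulVec [DecidableEq ι] {A : Matrix ι ι ℂ} (hA : A ∈ Matrix.unitaryGroup ι ℂ)
    (ψ : ι → ℂ) : normSq (A.mulVec ψ) = normSq ψ := by
  have h : (normSq (A.mulVec ψ) : ℂ) = normSq ψ := by
    rw [normSq_eq_dotProduct, normSq_eq_dotProduct, Matrix.star_mulVec, Matrix.dotProduct_mulVec,
      Matrix.vecMul_vecMul, ← Matrix.star_eq_conjTranspose, Matrix.mem_unitaryGroup_iff'.1 hA,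
      Matrix.vecMul_one]
  exact_mod_cast h

/-- The quotient form also covers `ψ = 0`, where `0 / 0 = 0`; this is the source of the dichotomy
that states have squared norm `0` or `1`. -/
theorem normSq_normalize (ψ : ι → ℂ) : normSq (normalize ψ) = normSq ψ / normSq ψ := by
  have h : ∀ x, ‖normalize ψ x‖ ^ 2 = ‖ψ x‖ ^ 2 / normSq ψ := fun x => by
    rw [normalize, norm_div, div_pow, Complex.norm_real, Real.norm_eq_abs, sq_abs,
      Real.sq_sqrt (normSq_nonneg ψ)]
  rw [normSq, Finset.sum_congr rfl fun x _ => h x, ← Finset.sum_div]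
  rfl

/-- Needed for frozen registers, which the normalization of the whole state must leave alone. -/
theorem normalize_eq_self {ψ : ι → ℂ} (h : normSq ψ = 0 ∨ normSq ψ = 1) : normalize ψ = ψ := by
  rcases h with h | h
  · rw [normSq_eq_zero.1 h]
    funext x
    simp [normalize]
  · funext x
    simp [normalize, h]

theorem normSq_tensor [DecidableEq κ] (ψ : κ → ι → ℂ) :
    normSq (fun w : κ → ι => ∏ j, ψ j (w j)) = ∏ j, normSq (ψ j) := by
  simp only [normSq, norm_prod, ← Finset.prod_pow]
  exact (Fintype.prod_sum fun j y => ‖ψ j y‖ ^ 2).symm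

theorem normalize_tensor [DecidableEq κ] (ψ : κ → ι → ℂ) :
    normalize (fun w : κ → ι => ∏ j, ψ j (w j)) = fun w => ∏ j, normalize (ψ j) (w j) := by
  funext w
  simp only [normalize, normSq_tensor, Finset.prod_div_distrib]
  rw [Real.sqrt_prod _ fun j _ => normSq_nonneg (ψ j), Complex.ofReal_prod]

theorem normalize_zero : normalize (0 : ι → ℂ) = 0 := normalize_eq_self (Or.inl normSq_zero)

end Norm

/-! ### Measurement projectors and query gates -/

theorem proj_zero {l : ℕ} (S : Finset (Fin l)) (n : S → Bool) : proj S n 0 = 0 := by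
  funext x
  simp [proj]

/-- The probabilities of the outcomes of a measurement add up to the squared norm. -/
theorem sum_normSq_proj {l : ℕ} (S : Finset (Fin l)) (ψ : Str l → ℂ) :
    ∑ n : S → Bool, normSq (proj S n ψ) = normSq ψ := by
  simp only [normSq]
  rw [Finset.sum_comm]
  refine Finset.sum_congr rfl fun x _ => ?_
  -- A basis string is compatible with exactly one outcome, its restriction to `S`.
  rw [Finset.sum_eq_single fun q : S => x q.1]
  · simp [proj]
  · intro n _ hn
    rw [proj, if_neg fun h => hn (funext fun q => (h q).symm)]
    simp
  · simp

theorem queryGate_mem_unitaryGroup {N l : ℕ} (o : Option (QueryWires N l)) (x : Fin N → Bool) :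
    queryGate o x ∈ Matrix.unitaryGroup (Str l) ℂ := by
  cases o with
  | none => exact one_mem _
  | some w =>
    rw [queryGate, Matrix.mem_unitaryGroup_iff, Matrix.star_eq_conjTranspose,
      Matrix.diagonal_conjTranspose, Matrix.diagonal_mul_diagonal, ← Matrix.diagonal_one]
    congr 1
    funext y
    simp only [queryPhase, Pi.star_apply]
    split_ifs <;> simp

namespace Circuit

variable {N l T : ℕ} (C : Circuit N l T) (x : Fin N → Bool)

/-! ### The original process -/

theorem state_succ (h : C.History) (i : Fin T) :
    C.state x h (i + 1) = (queryGate (C.query i) x).mulVec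
      (normalize (proj (C.S i) (h i) ((C.U i).1.mulVec (C.state x h i)))) := by
  rw [state, dif_pos i.2]

theorem normSq_state_zero (h : C.History) : normSq (C.state x h 0) = 1 := by
  rw [state, normSq, Finset.sum_eq_single fun _ => false]
  · simp
  · intro y _ hy
    simp [Pi.single_eq_of_ne hy]
  · simp

theorem normSq_state_succ (h : C.History) (i : Fin T) :
    normSq (C.state x h (i + 1)) = C.prob x h i / C.prob x h i := by
  rw [state_succ, normSq_mulVec (queryGate_mem_unitaryGroup _ _), normSq_normalize, prob]

theorem prob_nonneg (h : C.History) (i : Fin T) : 0 ≤ C.prob x h i := normSq_nonneg _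

theorem normSq_state_eq_zero_or_one (h : C.History) (t : ℕ) :
    normSq (C.state x h t) = 0 ∨ normSq (C.state x h t) = 1 := by
  induction t with
  | zero => exact Or.inr (C.normSq_state_zero x h)
  | succ t ih =>
    by_cases ht : t < T
    · have := C.normSq_state_succ x h ⟨t, ht⟩
      rcases eq_or_ne (C.prob x h ⟨t, ht⟩) 0 with h0 | h0
      · left; simpa [h0] using this
      · right; simpa [div_self h0] using this
    · rw [state, dif_neg ht]
      exact ih

/-- Once an outcome of probability zero has occurred, the state remains zero. -/
theorem state_eq_zero_of_le {h : C.History} {s t : ℕ} (hst : s ≤ t) (hs : C.state x h s = 0) :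
    C.state x h t = 0 := by
  induction t, hst using Nat.le_induction with
  | base => exact hs
  | succ t _ ih =>
    rw [state]
    split_ifs
    · rw [ih, Matrix.mulVec_zero, proj_zero, normalize_zero, Matrix.mulVec_zero]
    · exact ih

/-- A zero state at time `s` would persist up to step `i` and make the probability there zero. -/
theorem normSq_state_eq_one_of_prob_ne_zero {h : C.History} {i : Fin T} (hi : C.prob x h i ≠ 0)
    {s : ℕ} (hs : s ≤ i) : normSq (C.state x h s) = 1 := by
  refine (C.normSq_state_eq_zero_or_one x h s).resolve_left fun h0 => hi ?_
  rw [prob, C.state_eq_zero_of_le x hs (normSq_eq_zero.1 h0), Matrix.mulVec_zero, proj_zero,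
    normSq_zero]

theorem normSq_state_eq_one_of_forall {h : C.History} {t : ℕ} (ht : t ≤ T)
    (hp : ∀ i : Fin T, (i : ℕ) < t → C.prob x h i ≠ 0) : normSq (C.state x h t) = 1 := by
  cases t with
  | zero => exact C.normSq_state_zero x h
  | succ t =>
    have := C.normSq_state_succ x h ⟨t, ht⟩
    rwa [div_self (hp ⟨t, ht⟩ t.lt_succ_self)] at this

/-- The state depends only on the outcomes of the earlier steps. -/
theorem state_congr {h h' : C.History} {t : ℕ} (hh : ∀ i : Fin T, (i : ℕ) < t → h i = h' i) :
    C.state x h t = C.state x h' t := by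
  induction t with
  | zero => rfl
  | succ t ih =>
    have ih := ih fun i hi => hh i (hi.trans t.lt_succ_self)
    rw [state, state, ih]
    split_ifs with ht
    · rw [hh ⟨t, ht⟩ t.lt_succ_self]
    · rfl

theorem prob_congr {h h' : C.History} {i : Fin T} (hh : ∀ k ≤ i, h k = h' k) :
    C.prob x h i = C.prob x h' i := by
  rw [prob, prob, hh i le_rfl, C.state_congr x fun k hk => hh k (Fin.le_def.2 hk.le)]

/-- The right-hand side is not replaced by `1`, because it is `0` after an impossible outcome. -/
theorem sum_prob_update (h : C.History) (i : Fin T) :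
    ∑ n, C.prob x (Function.update h i n) i = normSq (C.state x h i) := by
  have hs : ∀ n, C.state x (Function.update h i n) i = C.state x h i := fun n =>
    C.state_congr x fun k hk => Function.update_of_ne (Fin.ne_of_lt hk) _ _
  simp only [prob, hs, Function.update_self]
  rw [sum_normSq_proj, normSq_mulVec (C.U i).2]

end Circuit

/-- Resampling one coordinate and averaging does not change a sum over a product. -/
theorem sum_sum_update {ι : Type} [Fintype ι] [DecidableEq ι] {β : ι → Type}
    [∀ i, Fintype (β i)] (i : ι) (f : (∀ i, β i) → ℝ) :
    ∑ h, ∑ n, f (Function.update h i n) = Fintype.card (β i) * ∑ h, f h := by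
  -- Swapping the fresh value with coordinate `i` is an involution on pairs.
  let e : (∀ i, β i) × β i ≃ (∀ i, β i) × β i :=
    { toFun := fun p => (Function.update p.1 i p.2, p.1 i)
      invFun := fun p => (Function.update p.1 i p.2, p.1 i)
      left_inv := fun p => by simp
      right_inv := fun p => by simp }
  calc ∑ h, ∑ n, f (Function.update h i n)
      = ∑ p : (∀ i, β i) × β i, f (e p).1 := (Fintype.sum_prod_type' _).symm
    _ = ∑ p : (∀ i, β i) × β i, f p.1 := Equiv.sum_comp e fun p => f p.1
    _ = Fintype.card (β i) * ∑ h, f h := by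
      rw [Fintype.sum_prod_type]
      simp [Finset.mul_sum]

/-! ### Total weight of outcome sequences and of samples -/

namespace Circuit

variable {N l T : ℕ} (C : Circuit N l T) (lay : Layout) (x : Fin N → Bool)

/-- If the outcomes are drawn from the process up to step `t` and uniformly afterwards, then their
weights add up to one. -/
theorem sum_prod_prob_of_le {t : ℕ} (ht : t ≤ T) :
    ∑ h : C.History, ∏ i : Fin T,
      (if (i : ℕ) < t then C.prob x h i else (Fintype.card (C.S i → Bool) : ℝ)⁻¹) = 1 := by
  induction t with
  | zero =>
    have hc : ∀ i, (Fintype.card (C.S i → Bool) : ℝ) ≠ 0 := fun i =>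
      Nat.cast_ne_zero.2 Fintype.card_ne_zero
    simp only [not_lt_zero, if_false, Finset.sum_const, Finset.card_univ, nsmul_eq_mul]
    rw [Fintype.card_pi, Nat.cast_prod, ← Finset.prod_mul_distrib]
    exact Finset.prod_eq_one fun i _ => mul_inv_cancel₀ (hc i)
  | succ t ih =>
    rw [← ih (Nat.le_of_succ_le ht)]
    let k : Fin T := ⟨t, ht⟩
    have hc : (Fintype.card (C.S k → Bool) : ℝ) ≠ 0 := Nat.cast_ne_zero.2 Fintype.card_ne_zero
    -- The factor `card` is traded for a sum over a resampled outcome of step `k`, the only step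
    -- whose weight changes.
    refine mul_left_cancel₀ hc ?_
    refine (sum_sum_update (β := fun i => C.S i → Bool) k _).symm.trans ?_
    rw [Finset.mul_sum]
    refine Finset.sum_congr rfl fun h _ => ?_
    have hk : ∀ i ∈ Finset.univ.erase k, (i : ℕ) ≠ t := fun i hi hit =>
      (Finset.mem_erase.1 hi).1 (Fin.ext hit)
    -- Earlier probabilities do not see the outcome at `k`, and later weights are still uniform.
    have hrest : ∀ n, ∏ i ∈ Finset.univ.erase k,
        (if (i : ℕ) < t + 1 then C.prob x (Function.update h k n) i
          else (Fintype.card (C.S i → Bool) : ℝ)⁻¹) =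
        ∏ i ∈ Finset.univ.erase k,
          (if (i : ℕ) < t then C.prob x h i else (Fintype.card (C.S i → Bool) : ℝ)⁻¹) := by
      intro n
      refine Finset.prod_congr rfl fun i hi => ?_
      have := hk i hi
      by_cases hit : (i : ℕ) < t
      · rw [if_pos hit, if_pos (hit.trans t.lt_succ_self)]
        refine C.prob_congr x fun m hm => Function.update_of_ne ?_ _ _
        exact Fin.ne_of_lt (lt_of_le_of_lt hm hit)
      · rw [if_neg hit, if_neg (by omega)]
    simp only [← Finset.mul_prod_erase Finset.univ _ (Finset.mem_univ k), hrest]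
    rw [← Finset.sum_mul, if_neg (lt_irrefl t), mul_inv_cancel_left₀ hc]
    simp only [k, Nat.lt_succ_self, if_true]
    rw [C.sum_prob_update x h k]
    -- If an earlier outcome is impossible, the probabilities at `k` need not sum to one, but the
    -- remaining product vanishes.
    by_cases hp : ∀ i : Fin T, (i : ℕ) < t → C.prob x h i ≠ 0
    · rw [C.normSq_state_eq_one_of_forall x (Nat.le_of_succ_le ht) hp, one_mul]
    · push Not at hp
      obtain ⟨i, hit, hi⟩ := hp
      rw [Finset.prod_eq_zero (i := i)
        (Finset.mem_erase.2 ⟨Fin.ne_of_lt hit, Finset.mem_univ _⟩) (by rw [if_pos hit, hi]),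
        mul_zero]

theorem sum_prod_prob : ∑ h : C.History, ∏ i, C.prob x h i = 1 := by
  rw [← C.sum_prod_prob_of_le x le_rfl]
  simp

theorem output_nonneg (v : C.Sample → Str l) : 0 ≤ C.output x v :=
  Finset.sum_nonneg fun h _ => mul_nonneg (Finset.prod_nonneg fun i _ => C.prob_nonneg x h i)
    (Finset.prod_nonneg fun _ _ => sq_nonneg _)

theorem normSq_state_succ_eq_one {h : C.History} (hp : ∏ i, C.prob x h i ≠ 0) (i : Fin T) :
    normSq (C.state x h (i + 1)) = 1 := by
  rw [normSq_state_succ, div_self (Finset.prod_ne_zero_iff.1 hp i (Finset.mem_univ i))]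

theorem sum_output : ∑ v, C.output x v = 1 := by
  rw [← C.sum_prod_prob x]
  simp only [output]
  rw [Finset.sum_comm]
  refine Finset.sum_congr rfl fun h _ => ?_
  rw [← Finset.mul_sum]
  by_cases hp : ∏ i, C.prob x h i = 0
  · rw [hp, zero_mul]
  · have hs : ∑ v : C.Sample → Str l, ∏ j : C.Sample, ‖C.state x h (j.1 + 1) (v j)‖ ^ 2 =
        ∏ j : C.Sample, normSq (C.state x h (j.1 + 1)) :=
      (Fintype.prod_sum fun (j : C.Sample) y => ‖C.state x h (j.1 + 1) y‖ ^ 2).symm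
    have hone : ∏ j : C.Sample, normSq (C.state x h (j.1 + 1)) = 1 :=
      Finset.prod_eq_one fun j _ => C.normSq_state_succ_eq_one x hp j.1
    rw [hs, hone, mul_one]

/-! ### The parallel circuit -/

/-- Distributivity: a sum over register strings of a product over registers is the product of the
sums for each register. -/
theorem onActive_mulVec_tensor (i : Fin T) (A : Matrix (Str l) (Str l) ℂ)
    (ψ : C.registers lay → Str l → ℂ) :
    (C.onActive lay i A).mulVec (fun w => ∏ j, ψ j (w j)) =
      fun w => ∏ j, (if i ≤ j.1 then A.mulVec (ψ j) else ψ j) (w j) := by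
  funext w
  simp only [Matrix.mulVec, dotProduct, onActive, ← Finset.prod_mul_distrib]
  rw [← Fintype.prod_sum fun j y => (if i ≤ j.1 then A (w j) y else
    (1 : Matrix (Str l) (Str l) ℂ) (w j) y) * ψ j y]
  refine Finset.prod_congr rfl fun j _ => ?_
  split_ifs
  · rfl
  · simp [Matrix.one_apply]

theorem starProj_tensor (i : Fin T) (n : C.S i → Bool) (ψ : C.registers lay → Str l → ℂ) :
    C.starProj lay i n (fun w => ∏ j, ψ j (w j)) =
      fun w => ∏ j, (if i ≤ j.1 then proj (C.S i) n (ψ j) else ψ j) (w j) := by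
  funext w
  rw [starProj]
  split_ifs with hw
  · refine Finset.prod_congr rfl fun j _ => ?_
    split_ifs with hij
    · rw [proj, if_pos (hw j hij)]
    · rfl
  -- One active register that contradicts the outcome already kills its factor.
  · push Not at hw
    obtain ⟨j, hij, q, hq⟩ := hw
    refine (Finset.prod_eq_zero (Finset.mem_univ j) ?_).symm
    rw [if_pos hij, proj, if_neg fun h => hq (h q)]

theorem starProj_onActive_tensor (i : Fin T) (h : C.History) (ψ : C.registers lay → Str l → ℂ) :
    C.starProj lay i (h i) ((C.onActive lay i (C.U i).1).mulVec fun w => ∏ j, ψ j (w j)) =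
      fun w => ∏ j, (if i ≤ j.1 then proj (C.S i) (h i) ((C.U i).1.mulVec (ψ j)) else ψ j)
        (w j) := by
  rw [onActive_mulVec_tensor, starProj_tensor]
  funext w
  refine Finset.prod_congr rfl fun j _ => ?_
  split_ifs <;> rfl

/-- The registers of `C*` are in a product state, each of them frozen after its own step. -/
theorem starState_eq_prod (h : C.History) {t : ℕ} (ht : t ≤ T) :
    C.starState lay x h t = fun w => ∏ j, C.state x h (min t (j.1 + 1)) (w j) := by
  induction t with
  | zero =>
    funext w
    simp only [starState, Nat.zero_min, state]
    by_cases hw : w = fun _ _ => false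
    · subst hw
      simp
    · rw [Pi.single_eq_of_ne hw]
      obtain ⟨j, hj⟩ := Function.ne_iff.1 hw
      exact (Finset.prod_eq_zero (Finset.mem_univ j) (Pi.single_eq_of_ne hj _)).symm
  | succ t ih =>
    rw [starState, dif_pos (show t < T from ht), ih (Nat.le_of_succ_le ht),
      C.starProj_onActive_tensor lay ⟨t, ht⟩ h, normalize_tensor, onActive_mulVec_tensor]
    funext w
    refine Finset.prod_congr rfl fun j _ => ?_
    -- An active register advances from `t` to `t + 1`; for an inactive one both minima equal `j +
    -- 1`.
    by_cases hj : (⟨t, ht⟩ : Fin T) ≤ j.1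
    · have hj' : t ≤ (j.1 : ℕ) := hj
      rw [if_pos hj, if_pos hj, min_eq_left (by omega), min_eq_left (by omega)]
      exact (congrFun (C.state_succ x h ⟨t, ht⟩) (w j)).symm
    · have hj' : ¬ t ≤ (j.1 : ℕ) := hj
      rw [if_neg hj, if_neg hj, min_eq_right (by omega), min_eq_right (by omega),
        normalize_eq_self (C.normSq_state_eq_zero_or_one x h _)]

theorem starState_final (h : C.History) (w : C.StarStr lay) :
    C.starState lay x h T w = ∏ j : C.registers lay, C.state x h (j.1 + 1) (w j) := by
  rw [C.starState_eq_prod lay x h le_rfl]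
  refine Finset.prod_congr rfl fun j _ => ?_
  rw [min_eq_right (show (j.1 : ℕ) + 1 ≤ T from j.1.2)]

theorem card_active (i : Fin T) :
    (Finset.univ.filter fun j : C.registers lay => i ≤ j.1).card = C.numActive lay i := by
  rw [numActive, ← Finset.card_map (Function.Embedding.subtype _)]
  congr 1
  ext j
  simp [and_comm]

/-- The `r` active copies give `a ^ r`, and the reweighting cancels all but one factor. The frozen
registers contribute `1` whenever `a ≠ 0`. -/
theorem starProb_eq_prob (h : C.History) (i : Fin T) : C.starProb lay x h i = C.prob x h i := by
  rw [starProb, reweight, C.starState_eq_prod lay x h i.2.le, starProj_onActive_tensor,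
    normSq_tensor]
  have hprod : ∏ j : C.registers lay, normSq (if i ≤ j.1 then
        proj (C.S i) (h i) ((C.U i).1.mulVec (C.state x h (min i (j.1 + 1))))
        else C.state x h (min i (j.1 + 1))) =
      C.prob x h i ^ C.numActive lay i * ∏ j : C.registers lay with ¬ i ≤ j.1,
        normSq (C.state x h (min i (j.1 + 1))) := by
    rw [← Finset.prod_filter_mul_prod_filter_not Finset.univ fun j : C.registers lay => i ≤ j.1,
      ← card_active, ← Finset.prod_const]
    congr 1
    · refine Finset.prod_congr rfl fun j hj => ?_
      have hij := (Finset.mem_filter.1 hj).2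
      have hij' : (i : ℕ) ≤ j.1 := hij
      rw [if_pos hij, min_eq_left (by omega), prob]
    · refine Finset.prod_congr rfl fun j hj => ?_
      rw [if_neg (Finset.mem_filter.1 hj).2]
  rw [hprod]
  -- For `a = 0` the weight vanishes for every `r`: if `r = 0` then `1 / 0 ^ (-1) = 0` by
  -- convention, and otherwise `0 ^ r = 0`.
  rcases eq_or_ne (C.prob x h i) 0 with h0 | h0
  · rw [h0]
    rcases Nat.lt_trichotomy (C.numActive lay i) 1 with hr | hr | hr
    · simp [Nat.lt_one_iff.1 hr]
    · simp [hr]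
    · rw [zero_pow (by omega), zero_mul, mul_zero]
  · rw [Finset.prod_eq_one fun j _ => C.normSq_state_eq_one_of_prob_ne_zero x h0 (min_le_left _ _),
      mul_one, zpow_sub_one₀ h0, zpow_natCast]
    field_simp

/-- Discarding normalized registers leaves the distribution of the others unchanged. -/
theorem sum_starState_eq {h : C.History} (hp : ∏ i, C.prob x h i ≠ 0) (v : C.Sample → Str l) :
    (∑ w : C.StarStr lay,
      if ∀ j : C.Sample, w ⟨j.1, C.sample_mem_registers lay j⟩ = v j then
        ‖C.starState lay x h T w‖ ^ 2 else 0) =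
      ∏ j : C.Sample, ‖C.state x h (j.1 + 1) (v j)‖ ^ 2 := by
  -- The constraint `w j = v j` moves into the factor of register `j`, so that the sum over `w`
  -- factorizes.
  let F : C.registers lay → Str l → ℝ := fun j y =>
    if hj : C.query j.1 = none then
      if y = v ⟨j.1, hj⟩ then ‖C.state x h (j.1 + 1) y‖ ^ 2 else 0
    else ‖C.state x h (j.1 + 1) y‖ ^ 2
  have hF : ∀ w : C.StarStr lay,
      (if ∀ j : C.Sample, w ⟨j.1, C.sample_mem_registers lay j⟩ = v j then
        ‖C.starState lay x h T w‖ ^ 2 else 0) = ∏ j, F j (w j) := by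
    intro w
    split_ifs with hw
    · rw [starState_final, norm_prod, ← Finset.prod_pow]
      refine Finset.prod_congr rfl fun j _ => ?_
      by_cases hj : C.query j.1 = none
      · simp only [F]
        rw [dif_pos hj, if_pos (hw ⟨j.1, hj⟩)]
      · simp only [F]
        rw [dif_neg hj]
    · push Not at hw
      obtain ⟨j, hj⟩ := hw
      refine (Finset.prod_eq_zero
        (Finset.mem_univ (⟨j.1, C.sample_mem_registers lay j⟩ : C.registers lay)) ?_).symm
      simp only [F]
      rw [dif_pos j.2, if_neg hj]
  have hsum : ∀ j, ∑ y, F j y = if hj : C.query j.1 = none then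
      ‖C.state x h (j.1 + 1) (v ⟨j.1, hj⟩)‖ ^ 2 else 1 := by
    intro j
    by_cases hj : C.query j.1 = none
    · simp [F, hj]
    · simp only [F, dif_neg hj]
      exact C.normSq_state_succ_eq_one x hp j.1
  rw [Finset.sum_congr rfl fun w _ => hF w, ← Fintype.prod_sum F,
    Finset.prod_congr rfl fun j _ => hsum j]
  symm
  -- Registers outside the image of the samples belong to query steps and have factor `1`.
  refine Finset.prod_of_injOn (fun j : C.Sample => ⟨j.1, C.sample_mem_registers lay j⟩) ?_ ?_ ?_ ?_
  · intro j _ k _ hjk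
    exact Subtype.ext (congrArg (fun r : C.registers lay => r.1) hjk)
  · intro j _
    exact Finset.mem_coe.2 (Finset.mem_univ _)
  · intro j _ hj
    refine dif_neg fun hq => hj ⟨⟨j.1, hq⟩, by simp, rfl⟩
  · intro j _
    rw [dif_pos j.2]

theorem starOutput_eq_output (v : C.Sample → Str l) : C.starOutput lay x v = C.output x v := by
  rw [starOutput, output]
  refine Finset.sum_congr rfl fun h _ => ?_
  simp only [starProb_eq_prob]
  by_cases hp : ∏ i, C.prob x h i = 0
  · rw [hp, zero_mul, zero_mul]
  · rw [C.sum_starState_eq lay x hp v]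

end Circuit

/-! ### The oracles and the query models -/

/-- The answer weights agree for every query, so no machine can tell the oracles apart. -/
theorem oracleQ_eq_oracleQStar (G : GateSet) : oracleQ G = oracleQStar G := by
  simp only [oracleQ, oracleQStar, Circuit.starOutput_eq_output]

theorem cost_eq_starCost {N : ℕ} (lay : Layout) (D : Set (Fin N → Bool))
    (f : (Fin N → Bool) → Bool) : cost D f = starCost lay D f := by
  have h : ∀ {l T : ℕ} (C : Circuit N l T), C.starOutput lay = C.output := fun C =>
    funext fun x => funext fun v => C.starOutput_eq_output lay x v
  simp only [cost, starCost, h]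

end NonCollapsing

theorem mainTheorem6 :
    -- the two complexity classes are equal, for circuits over any finite gate set
    (∀ G : NonCollapsing.GateSet, NonCollapsing.PDQP G = NonCollapsing.PDQPStar G) ∧
    -- `C*` reproduces the collapsing measurements, the states and the samples of `C`
    (∀ (N l T : ℕ) (C : NonCollapsing.Circuit N l T) (lay : NonCollapsing.Layout)
        (x : Fin N → Bool),
      (∀ (h : C.History) (i : Fin T), C.starProb lay x h i = C.prob x h i) ∧
      (∀ (h : C.History) (w : C.StarStr lay),
        C.starState lay x h T w = ∏ j : C.registers lay, C.state x h (j.1 + 1) (w j)) ∧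
      (∀ v : C.Sample → NonCollapsing.Str l, C.starOutput lay x v = C.output x v) ∧
      (∀ v : C.Sample → NonCollapsing.Str l, 0 ≤ C.output x v) ∧
      ∑ v : C.Sample → NonCollapsing.Str l, C.output x v = 1) ∧
    -- the two query models have equal query complexity
    (∀ (N : ℕ) (D : Set (Fin N → Bool)) (f : (Fin N → Bool) → Bool) (lay : NonCollapsing.Layout),
      NonCollapsing.cost D f = NonCollapsing.starCost lay D f ∧
      NonCollapsing.leastTotal (NonCollapsing.cost D f) =
        NonCollapsing.leastTotal (NonCollapsing.starCost lay D f)) := by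
  refine ⟨fun G => ?_, fun N l T C lay x => ⟨fun h i => C.starProb_eq_prob lay x h i,
    fun h w => C.starState_final lay x h w, fun v => C.starOutput_eq_output lay x v,
    fun v => C.output_nonneg x v, C.sum_output x⟩, fun N D f lay => ?_⟩
  · rw [NonCollapsing.PDQP, NonCollapsing.PDQPStar, NonCollapsing.oracleQ_eq_oracleQStar]
  · have h := NonCollapsing.cost_eq_starCost lay D f
    exact ⟨h, congrArg NonCollapsing.leastTotal h⟩
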